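/- For a finite set $P$ of points in general position in the plane (no three collinear), let $\overline{\mathrm{cr}}(P)$ denote the number of crossings in the complete geometric graph with vertex set $P$ (all edges drawn as straight line segments), i.e. the number of unordered pairs of edges without a common endpoint whose segments intersect. For $n\ge 0$ let $\overline{\mathrm{cr}}(K_n)$ denote the rectilinear crossing number of $K_n$, the minimum of $\overline{\mathrm{cr}}(Q)$ over all $n$-point sets $Q$ in general position in the plane. Theorem. Let $m\ge 3$ be an odd integer and let $P$ be an $m$-element point set in general position in the plane. Then $$\overline{\mathrm{cr}}(K_n)\;\le\;\frac{24\,\overline{\mathrm{cr}}(P)+3m^3-7m^2+\frac{30}{7}m}{m^4}\binom{n}{4}+\Theta(n^3),$$ that is, there is a function $g:\mathbb{N}\to\mathbb{R}$ (which may depend on $P$) with $g(n)=\Theta(n^3)$ as $n\to\infty$ such that, for every $n$, $\overline{\mathrm{cr}}(K_n)$ is at most the first term on the right plus $g(n)$. -/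

import Mathlib

open Filter Asymptotics

/-- The Euclidean plane. -/
abbrev Plane : Type := EuclideanSpace ℝ (Fin 2)

/-- A finite point set is in general position if no three of its points are collinear. -/
def InGeneralPosition (P : Finset Plane) : Prop :=
  ∀ p ∈ P, ∀ q ∈ P, ∀ r ∈ P, p ≠ q → p ≠ r → q ≠ r → ¬ Collinear ℝ {p, q, r}

/-- An edge is given by the set of its two endpoints, and is drawn as the straight line segment
between them, that is, as the convex hull of its endpoints. Two edges cross if they have no
common endpoint and the two segments meet. -/
def EdgesCross (e f : Finset Plane) : Prop :=
  Disjoint e f ∧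
    (convexHull ℝ (e : Set Plane) ∩ convexHull ℝ (f : Set Plane)).Nonempty

open Classical in
/-- The number of crossings of the complete geometric graph with vertex set `P`: the number of
unordered pairs of edges that cross. -/
noncomputable def crossings (P : Finset Plane) : ℕ :=
  (((P.powersetCard 2).powersetCard 2).filter
    (fun E : Finset (Finset Plane) => (E : Set (Finset Plane)).Pairwise EdgesCross)).card

/-- The rectilinear crossing number of the complete graph on `n` vertices: the minimum number of
crossings over all `n`-point sets in general position. -/
noncomputable def rectilinearCrossingNumber (n : ℕ) : ℕ :=
  sInf {k : ℕ | ∃ P : Finset Plane, P.card = n ∧ InGeneralPosition P ∧ crossings P = k}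

/-- For every `n` there is an `n`-point set in general position (points of a parabola). -/
theorem exists_inGeneralPosition (n : ℕ) :
    ∃ P : Finset Plane, P.card = n ∧ InGeneralPosition P := by
  have hinj : Function.Injective (fun i : ℕ => (!₂[(i : ℝ), (i : ℝ) ^ 2] : Plane)) := by
    intro i j h
    have h0 := congrArg (fun v : Plane => v 0) h
    simpa using h0
  refine ⟨(Finset.range n).map ⟨_, hinj⟩, by simp, ?_⟩
  intro p hp q hq r hr hpq hpr hqr hcol
  simp only [Finset.mem_map, Finset.mem_range, Function.Embedding.coeFn_mk] at hp hq hr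
  obtain ⟨i, -, rfl⟩ := hp
  obtain ⟨j, -, rfl⟩ := hq
  obtain ⟨k, -, rfl⟩ := hr
  have hij : (i : ℝ) ≠ j := fun h => hpq (by rw [h])
  have hik : (i : ℝ) ≠ k := fun h => hpr (by rw [h])
  have hjk : (j : ℝ) ≠ k := fun h => hqr (by rw [h])
  rw [collinear_iff_of_mem (p₀ := !₂[(i : ℝ), (i : ℝ) ^ 2]) (by simp)] at hcol
  obtain ⟨v, hv⟩ := hcol
  obtain ⟨s, hs⟩ := hv (!₂[(j : ℝ), (j : ℝ) ^ 2]) (by simp)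
  obtain ⟨t, ht⟩ := hv (!₂[(k : ℝ), (k : ℝ) ^ 2]) (by simp)
  have s0 := congrArg (fun v : Plane => v 0) hs
  have s1 := congrArg (fun v : Plane => v 1) hs
  have t0 := congrArg (fun v : Plane => v 0) ht
  have t1 := congrArg (fun v : Plane => v 1) ht
  simp at s0 s1 t0 t1
  have key : ((j : ℝ) - i) * ((k : ℝ) - i) * ((k : ℝ) - j) = 0 := by
    have e1 : (j : ℝ) - i = s * v 0 := by linarith
    have e2 : (k : ℝ) - i = t * v 0 := by linarith
    have e3 : (j : ℝ) ^ 2 - (i : ℝ) ^ 2 = s * v 1 := by linarith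
    have e4 : (k : ℝ) ^ 2 - (i : ℝ) ^ 2 = t * v 1 := by linarith
    have e5 : ((j : ℝ) - i) * ((k : ℝ) ^ 2 - (i : ℝ) ^ 2)
        = ((k : ℝ) - i) * ((j : ℝ) ^ 2 - (i : ℝ) ^ 2) := by
      rw [e1, e2, e3, e4]; ring
    linear_combination e5
  rcases mul_eq_zero.mp key with h | h
  · rcases mul_eq_zero.mp h with h | h
    · exact hij (by linarith)
    · exact hik (by linarith)
  · exact hjk (by linarith)

/-- The minimum in the definition of the rectilinear crossing number is attained. -/
theorem exists_crossings_eq_rectilinearCrossingNumber (n : ℕ) :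
    ∃ P : Finset Plane, P.card = n ∧ InGeneralPosition P ∧
      crossings P = rectilinearCrossingNumber n := by
  obtain ⟨P, hc, hP⟩ := exists_inGeneralPosition n
  exact Nat.sInf_mem
    (s := {k : ℕ | ∃ P : Finset Plane, P.card = n ∧ InGeneralPosition P ∧ crossings P = k})
    ⟨_, P, hc, hP, rfl⟩

/-! Replace every point `a` of an `n`-point set by two nearby points on a line through `a` that
halves the other points. A crossing of the old set yields 16 crossings. The only other crossings
come from edges at the two different copies of a common point `a`: edges to `b` and `d` cross in
exactly one of the two assignments of copies of `a` when `b` and `d` lie on the same side of the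
splitting line, and in none otherwise. Halving makes the number of such same-side pairs explicit,
and with `x` the number of ordered crossing quadruples (eight per crossing) one gets `x' ≤ 16 x + 8
n (n - 1) ^ 2 - 12 n (n - 1)` (`IsDoubling.numCross_le`). The polynomial in `doublingPotential`
absorbs the extra term, so the potential grows at most by the factor 16 while `n` doubles.

To repeat this, the lines must be available again. The invariant is `IsLineMatching`: each `a` has a
line through a second point `f a`, exactly halving or off by one, and different points have
different lines. An odd set has such a matching off by one (`exists_isLineMatching_of_odd`); a
slight rotation makes the lines halving. Every doubling produces a matching by exact halving lines
(`IsDoubling.exists_isLineMatching`).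

Finally the ratio of the crossing number of `K_n` to `n.choose 4` is nondecreasing, so it is bounded
for every `n` by the limit along the doubled sets. This gives the bound with no error term at all.
-/

/-! ### Orientations and order types -/

/-- The cross product (determinant) of two plane vectors. -/
def cross (x y : Plane) : ℝ := x 0 * y 1 - x 1 * y 0

/-- Twice the signed area of the triangle `x y z`. -/
def orient (x y z : Plane) : ℝ := cross (y - x) (z - x)

theorem orient_eq (x y z : Plane) :
    orient x y z = (y 0 - x 0) * (z 1 - x 1) - (y 1 - x 1) * (z 0 - x 0) := by
  simp [orient, cross]

@[simp]
theorem orient_self_left (x z : Plane) : orient x x z = 0 := by simp [orient_eq]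

@[simp]
theorem orient_self_right (x y : Plane) : orient x y y = 0 := by rw [orient_eq]; ring

@[simp]
theorem orient_self_outer (x y : Plane) : orient x y x = 0 := by simp [orient_eq]

theorem orient_eq_zero_of_collinear {x y z : Plane} (h : Collinear ℝ {x, y, z}) :
    orient x y z = 0 := by
  rw [collinear_iff_of_mem (p₀ := x) (by simp)] at h
  obtain ⟨v, hv⟩ := h
  obtain ⟨s, rfl⟩ := hv y (by simp)
  obtain ⟨t, rfl⟩ := hv z (by simp)
  simp [orient_eq]
  ring

theorem collinear_of_orient_eq_zero {x y z : Plane} (hxy : x ≠ y) (h : orient x y z = 0) :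
    Collinear ℝ {x, y, z} := by
  rw [collinear_iff_of_mem (p₀ := x) (by simp)]
  rw [orient_eq] at h
  refine ⟨y - x, ?_⟩
  have hne : y 0 - x 0 ≠ 0 ∨ y 1 - x 1 ≠ 0 := by
    by_contra! hc
    apply hxy
    ext i
    fin_cases i
    · simp; linarith [hc.1]
    · simp; linarith [hc.2]
  intro w hw
  simp only [Set.mem_insert_iff, Set.mem_singleton_iff] at hw
  rcases hw with rfl | rfl | rfl
  · exact ⟨0, by simp⟩
  · exact ⟨1, by simp⟩
  · rcases hne with hne | hne
    · refine ⟨(w 0 - x 0) / (y 0 - x 0), ?_⟩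
      ext i
      fin_cases i
      · simp; field_simp; ring
      · simp; field_simp; linarith
    · refine ⟨(w 1 - x 1) / (y 1 - x 1), ?_⟩
      ext i
      fin_cases i
      · simp; field_simp; linarith
      · simp; field_simp; ring

/-- The order type of an indexed family of points. -/
noncomputable def chi {ι : Type*} (p : ι → Plane) (a b c : ι) : SignType :=
  SignType.sign (orient (p a) (p b) (p c))

theorem chi_swap {ι : Type*} (p : ι → Plane) (a b c : ι) : chi p b a c = -chi p a b c := by
  rw [chi, chi, ← Left.sign_neg]
  congr 1
  simp only [orient_eq]; ring

theorem chi_rotate {ι : Type*} (p : ι → Plane) (a b c : ι) : chi p b c a = chi p a b c := by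
  rw [chi, chi]
  congr 1
  simp only [orient_eq]; ring

/-- The pairs `a b` and `c d` cross with respect to the orientation signs `χ`. -/
def ChiCross {α : Type*} (χ : α → α → α → SignType) (a b c d : α) : Prop :=
  χ a b c * χ a b d = -1 ∧ χ c d a * χ c d b = -1

instance {α : Type*} (χ : α → α → α → SignType) (a b c d : α) :
    Decidable (ChiCross χ a b c d) := by
  unfold ChiCross; infer_instance

/-- The number of ordered quadruples `a b c d` such that `a b` crosses `c d`. -/
def numCross {α : Type*} [Fintype α] (χ : α → α → α → SignType) : ℕ :=
  ∑ a, ∑ b, ∑ c, ∑ d, if ChiCross χ a b c d then 1 else 0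

theorem ChiCross.symm {α : Type*} {χ : α → α → α → SignType} {a b c d : α}
    (h : ChiCross χ a b c d) : ChiCross χ c d a b := ⟨h.2, h.1⟩

theorem ChiCross.swap_right {α : Type*} {χ : α → α → α → SignType}
    (hs : ∀ a b c, χ b a c = -χ a b c) {a b c d : α}
    (h : ChiCross χ a b c d) : ChiCross χ a b d c := by
  refine ⟨by rw [mul_comm]; exact h.1, ?_⟩
  rw [hs c d, hs c d, neg_mul_neg]
  exact h.2

theorem ChiCross.swap_left {α : Type*} {χ : α → α → α → SignType}
    (hs : ∀ a b c, χ b a c = -χ a b c) {a b c d : α}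
    (h : ChiCross χ a b c d) : ChiCross χ b a c d :=
  (h.symm.swap_right hs).symm

/-! ### Geometric crossings in terms of orientation signs -/

theorem sign_mul_sign_eq_neg_one {x y : ℝ} :
    SignType.sign x * SignType.sign y = -1 ↔ x * y < 0 := by
  rw [← sign_mul, sign_eq_neg_one_iff]

theorem mem_segment_iff_lin {x y z : Plane} :
    z ∈ segment ℝ x y ↔ ∃ t : ℝ, 0 ≤ t ∧ t ≤ 1 ∧ z 0 = x 0 + t * (y 0 - x 0) ∧
      z 1 = x 1 + t * (y 1 - x 1) := by
  rw [segment_eq_image']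
  constructor
  · rintro ⟨t, ⟨h0, h1⟩, rfl⟩
    exact ⟨t, h0, h1, by simp, by simp⟩
  · rintro ⟨t, h0, h1, e0, e1⟩
    refine ⟨t, ⟨h0, h1⟩, ?_⟩
    ext i
    fin_cases i
    · simp [e0]
    · simp [e1]

/-- The function `orient x y ·` is affine, so along a segment with end values `A`, `B` of opposite
sign it vanishes at the parameter `A / (A - B)`. The parameters so found on the two segments give
the same point. -/
theorem segment_inter_of_orient {x y z w : Plane} (h1 : orient x y z * orient x y w < 0)
    (h2 : orient z w x * orient z w y < 0) :
    (segment ℝ x y ∩ segment ℝ z w).Nonempty := by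
  have key : ∀ A B : ℝ, A * B < 0 → A - B ≠ 0 ∧ 0 ≤ A / (A - B) ∧ A / (A - B) ≤ 1 := by
    intro A B h
    rcases mul_neg_iff.mp h with ⟨ha, hb⟩ | ⟨ha, hb⟩
    · refine ⟨by linarith, div_nonneg ha.le (by linarith), ?_⟩
      rw [div_le_one (by linarith)]; linarith
    · refine ⟨by linarith, div_nonneg_of_nonpos ha.le (by linarith), ?_⟩
      rw [div_le_one_of_neg (by linarith)]; linarith
  obtain ⟨n1, a1, b1⟩ := key _ _ h1
  obtain ⟨n2, a2, b2⟩ := key _ _ h2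
  set t := orient x y z / (orient x y z - orient x y w) with ht
  set u := orient z w x / (orient z w x - orient z w y) with hu
  refine ⟨!₂[x 0 + u * (y 0 - x 0), x 1 + u * (y 1 - x 1)],
    mem_segment_iff_lin.2 ⟨u, a2, b2, by simp, by simp⟩,
    mem_segment_iff_lin.2 ⟨t, a1, b1, ?_, ?_⟩⟩
  · simp only [ht, hu, Matrix.cons_val_zero]
    field_simp
    simp only [orient_eq]; ring
  · simp only [ht, hu, Matrix.cons_val_one, Matrix.cons_val_zero]
    field_simp
    simp only [orient_eq]; ring

/-- At a common point the affine function `orient x y ·` vanishes, and its value there is a convex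
combination of the values at `z` and `w`. -/
theorem orient_mul_nonpos_of_segment_inter {x y z w : Plane}
    (h : (segment ℝ x y ∩ segment ℝ z w).Nonempty) : orient x y z * orient x y w ≤ 0 := by
  obtain ⟨q, hq1, hq2⟩ := h
  obtain ⟨u, -, -, u0, u1⟩ := mem_segment_iff_lin.1 hq1
  obtain ⟨t, t0, t1, e0, e1⟩ := mem_segment_iff_lin.1 hq2
  have hz : (1 - t) * orient x y z + t * orient x y w = 0 := by
    have h0 : z 0 + t * (w 0 - z 0) = x 0 + u * (y 0 - x 0) := by rw [← e0, u0]
    have h1 : z 1 + t * (w 1 - z 1) = x 1 + u * (y 1 - x 1) := by rw [← e1, u1]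
    simp only [orient_eq]
    linear_combination (y 0 - x 0) * h1 - (y 1 - x 1) * h0
  by_contra! hpos
  rcases mul_pos_iff.mp hpos with ⟨ha, hb⟩ | ⟨ha, hb⟩
  · nlinarith [mul_nonneg (sub_nonneg.2 t1) ha.le, mul_nonneg t0 hb.le]
  · nlinarith [mul_nonneg (sub_nonneg.2 t1) (neg_nonneg.2 ha.le),
      mul_nonneg t0 (neg_nonneg.2 hb.le)]

theorem orient_ne_zero_of_inGeneralPosition {S : Finset Plane} (hS : InGeneralPosition S)
    {x y z : Plane} (hx : x ∈ S) (hy : y ∈ S) (hz : z ∈ S) (hxy : x ≠ y) (hxz : x ≠ z)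
    (hyz : y ≠ z) : orient x y z ≠ 0 :=
  fun h => hS x hx y hy z hz hxy hxz hyz (collinear_of_orient_eq_zero hxy h)

theorem ChiCross.pairwise_ne {x y z w : Plane} (h : ChiCross (chi id) x y z w) :
    x ≠ y ∧ z ≠ w ∧ x ≠ z ∧ x ≠ w ∧ y ≠ z ∧ y ≠ w := by
  simp only [ChiCross, chi, id, sign_mul_sign_eq_neg_one] at h
  refine ⟨?_, ?_, ?_, ?_, ?_, ?_⟩ <;> rintro rfl <;> simp at h

theorem edgesCross_iff {S : Finset Plane} (hS : InGeneralPosition S) {x y z w : Plane}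
    (hx : x ∈ S) (hy : y ∈ S) (hz : z ∈ S) (hw : w ∈ S) (hxy : x ≠ y) (hzw : z ≠ w) :
    EdgesCross {x, y} {z, w} ↔ ChiCross (chi id) x y z w := by
  classical
  have hcoe : ∀ a b : Plane, convexHull ℝ ((({a, b} : Finset Plane)) : Set Plane)
      = segment ℝ a b := by
    intro a b; rw [Finset.coe_pair, convexHull_pair]
  rw [EdgesCross, hcoe, hcoe]
  constructor
  · rintro ⟨hd, hne⟩
    simp only [Finset.disjoint_insert_left, Finset.disjoint_singleton_left, Finset.mem_insert,
      Finset.mem_singleton, not_or] at hd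
    obtain ⟨⟨hxz, hxw⟩, hyz, hyw⟩ := hd
    replace hxz : x ≠ z := hxz
    replace hxw : x ≠ w := hxw
    replace hyz : y ≠ z := hyz
    replace hyw : y ≠ w := hyw
    have hne' := hne
    rw [Set.inter_comm] at hne'
    constructor
    · refine sign_mul_sign_eq_neg_one.2
        (lt_of_le_of_ne (orient_mul_nonpos_of_segment_inter hne) (mul_ne_zero ?_ ?_))
      · exact orient_ne_zero_of_inGeneralPosition hS hx hy hz hxy hxz hyz
      · exact orient_ne_zero_of_inGeneralPosition hS hx hy hw hxy hxw hyw
    · refine sign_mul_sign_eq_neg_one.2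
        (lt_of_le_of_ne (orient_mul_nonpos_of_segment_inter hne') (mul_ne_zero ?_ ?_))
      · exact orient_ne_zero_of_inGeneralPosition hS hz hw hx hzw hxz.symm hxw.symm
      · exact orient_ne_zero_of_inGeneralPosition hS hz hw hy hzw hyz.symm hyw.symm
  · intro h
    obtain ⟨-, -, h1, h2, h3, h4⟩ := h.pairwise_ne
    refine ⟨?_, segment_inter_of_orient (sign_mul_sign_eq_neg_one.1 h.1)
      (sign_mul_sign_eq_neg_one.1 h.2)⟩
    simp [h1.symm, h2.symm, h3.symm, h4.symm]

theorem Finset.pair_eq_pair_iff' {α : Type*} [DecidableEq α] {a b c d : α} :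
    ({a, b} : Finset α) = {c, d} ↔ a = c ∧ b = d ∨ a = d ∧ b = c := by
  rw [← Finset.coe_inj, Finset.coe_pair, Finset.coe_pair, Set.pair_eq_pair_iff]

-- The factor 8 counts the orders of the two edges and of the endpoints within each edge.
open Classical in
theorem card_filter_chiCross {S : Finset Plane} (hS : InGeneralPosition S) :
    ((S ×ˢ S ×ˢ S ×ˢ S).filter
      (fun t => ChiCross (chi id) t.1 t.2.1 t.2.2.1 t.2.2.2)).card = 8 * crossings S := by
  rw [crossings, mul_comm, Finset.card_eq_sum_card_fiberwise
    (f := fun t : Plane × Plane × Plane × Plane =>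
      ({{t.1, t.2.1}, {t.2.2.1, t.2.2.2}} : Finset (Finset Plane)))
    (t := ((S.powersetCard 2).powersetCard 2).filter
      (fun E : Finset (Finset Plane) => (E : Set (Finset Plane)).Pairwise EdgesCross))]
  · refine Finset.sum_const_nat ?_
    intro E hE
    simp only [Finset.mem_filter, Finset.mem_powersetCard] at hE
    obtain ⟨⟨hsub, hE2⟩, hpair⟩ := hE
    obtain ⟨e, f, hef, rfl⟩ := Finset.card_eq_two.1 hE2
    have he := hsub (Finset.mem_insert_self e _)
    have hf := hsub (Finset.mem_insert_of_mem (Finset.mem_singleton_self f))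
    rw [Finset.mem_powersetCard] at he hf
    obtain ⟨heS, he2⟩ := he
    obtain ⟨hfS, hf2⟩ := hf
    obtain ⟨x, y, hxy, rfl⟩ := Finset.card_eq_two.1 he2
    obtain ⟨z, w, hzw, rfl⟩ := Finset.card_eq_two.1 hf2
    have hx : x ∈ S := heS (by simp)
    have hy : y ∈ S := heS (by simp)
    have hz : z ∈ S := hfS (by simp)
    have hw : w ∈ S := hfS (by simp)
    have hX : ChiCross (chi id) x y z w :=
      (edgesCross_iff hS hx hy hz hw hxy hzw).1 (hpair (by simp) (by simp) hef)
    obtain ⟨-, -, h1, h2, h3, h4⟩ := hX.pairwise_ne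
    have hsw := chi_swap (id : Plane → Plane)
    have hfib : ((S ×ˢ S ×ˢ S ×ˢ S).filter
        (fun t => ChiCross (chi id) t.1 t.2.1 t.2.2.1 t.2.2.2)).filter
        (fun t : Plane × Plane × Plane × Plane =>
          ({{t.1, t.2.1}, {t.2.2.1, t.2.2.2}} : Finset (Finset Plane)) = {{x, y}, {z, w}})
        = {(x, y, z, w), (y, x, z, w), (x, y, w, z), (y, x, w, z),
          (z, w, x, y), (z, w, y, x), (w, z, x, y), (w, z, y, x)} := by
      ext ⟨a, b, c, d⟩
      simp only [Finset.mem_filter, Finset.mem_product, Finset.mem_insert, Finset.mem_singleton,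
        Prod.mk.injEq, Finset.pair_eq_pair_iff']
      constructor
      · rintro ⟨-, ⟨h | h, h' | h'⟩ | ⟨h | h, h' | h'⟩⟩ <;> simp [h.1, h.2, h'.1, h'.2]
      · have hA := hX.swap_left hsw
        have hB := hX.swap_right hsw
        have hC := hA.swap_right hsw
        rintro (h | h | h | h | h | h | h | h) <;> obtain ⟨rfl, rfl, rfl, rfl⟩ := h
        · exact ⟨⟨⟨hx, hy, hz, hw⟩, hX⟩, by simp⟩
        · exact ⟨⟨⟨hy, hx, hz, hw⟩, hA⟩, by simp⟩
        · exact ⟨⟨⟨hx, hy, hw, hz⟩, hB⟩, by simp⟩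
        · exact ⟨⟨⟨hy, hx, hw, hz⟩, hC⟩, by simp⟩
        · exact ⟨⟨⟨hz, hw, hx, hy⟩, hX.symm⟩, by simp⟩
        · exact ⟨⟨⟨hz, hw, hy, hx⟩, hA.symm⟩, by simp⟩
        · exact ⟨⟨⟨hw, hz, hx, hy⟩, hB.symm⟩, by simp⟩
        · exact ⟨⟨⟨hw, hz, hy, hx⟩, hC.symm⟩, by simp⟩
    rw [hfib]
    repeat rw [Finset.card_insert_of_notMem (by
      simp [hxy, hxy.symm, hzw, hzw.symm, h1, h2, h3, h4, h1.symm, h2.symm, h3.symm, h4.symm])]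
    simp
  · rintro ⟨a, b, c, d⟩ ht
    simp only [Finset.coe_filter, Finset.mem_product, Set.mem_ofPred_eq] at ht
    obtain ⟨⟨ha, hb, hc, hd⟩, hX⟩ := ht
    obtain ⟨hab, hcd, h1, h2, h3, h4⟩ := hX.pairwise_ne
    have hE := (edgesCross_iff hS ha hb hc hd hab hcd).2 hX
    have hE' := (edgesCross_iff hS hc hd ha hb hcd hab).2 hX.symm
    have hne : ({a, b} : Finset Plane) ≠ {c, d} := by
      intro h
      rw [Finset.pair_eq_pair_iff'] at h
      tauto
    simp only [Finset.coe_filter, Finset.mem_powersetCard, Set.mem_ofPred_eq]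
    refine ⟨⟨?_, Finset.card_pair hne⟩, ?_⟩
    · intro e he
      simp only [Finset.mem_insert, Finset.mem_singleton] at he
      rw [Finset.mem_powersetCard]
      rcases he with rfl | rfl
      · exact ⟨by simp [Finset.insert_subset_iff, ha, hb], Finset.card_pair hab⟩
      · exact ⟨by simp [Finset.insert_subset_iff, hc, hd], Finset.card_pair hcd⟩
    · rw [Finset.coe_pair, Set.pairwise_pair]
      exact fun _ => ⟨hE, hE'⟩

/-! ### Indexed families in general position -/

/-- No three members of the family are collinear. -/
def Generic {ι : Type*} (p : ι → Plane) : Prop :=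
  ∀ a b c, a ≠ b → a ≠ c → b ≠ c → chi p a b c ≠ 0

theorem Generic.injective {ι : Type*} [Fintype ι] {p : ι → Plane} (hp : Generic p)
    (h3 : 3 ≤ Fintype.card ι) : Function.Injective p := by
  classical
  intro a b hab
  by_contra hne
  have hlt : ({a, b} : Finset ι).card < (Finset.univ : Finset ι).card := by
    rw [Finset.card_pair hne, Finset.card_univ]; omega
  obtain ⟨c, -, hc⟩ := Finset.exists_mem_notMem_of_card_lt_card hlt
  simp only [Finset.mem_insert, Finset.mem_singleton, not_or] at hc
  apply hp a b c hne (Ne.symm hc.1) (Ne.symm hc.2)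
  simp [chi, hab]

theorem inGeneralPosition_map {ι : Type*} [Fintype ι] (p : ι ↪ Plane) (hp : Generic p) :
    InGeneralPosition (Finset.univ.map p) := by
  intro x hx y hy z hz hxy hxz hyz hcol
  simp only [Finset.mem_map, Finset.mem_univ, true_and] at hx hy hz
  obtain ⟨a, rfl⟩ := hx
  obtain ⟨b, rfl⟩ := hy
  obtain ⟨c, rfl⟩ := hz
  apply hp a b c (by rintro rfl; exact hxy rfl) (by rintro rfl; exact hxz rfl)
    (by rintro rfl; exact hyz rfl)
  simp [chi, orient_eq_zero_of_collinear hcol]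

theorem eight_mul_crossings_map {ι : Type*} [Fintype ι] (p : ι ↪ Plane) (hp : Generic p) :
    8 * crossings (Finset.univ.map p) = numCross (chi p) := by
  classical
  rw [← card_filter_chiCross (inGeneralPosition_map p hp), Finset.card_filter,
    Finset.sum_product, numCross, Finset.sum_map]
  refine Finset.sum_congr rfl fun a _ => ?_
  rw [Finset.sum_product, Finset.sum_map]
  refine Finset.sum_congr rfl fun b _ => ?_
  rw [Finset.sum_product, Finset.sum_map]
  refine Finset.sum_congr rfl fun c _ => ?_
  rw [Finset.sum_map]
  rfl

/-! ### Counting crossings after doubling, from signs alone -/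

/-- The sign attached to the two copies of a point. -/
def boolSign : Bool → SignType
  | true => 1
  | false => -1

/-- `χ'` is the order type of a family obtained from a family with order type `χ` by splitting
every point `a` into two close points `(a, true)` and `(a, false)`, where `τ a b j` is the side of
the line through the copies of `a` on which the point `(b, j)` lies. -/
structure IsDoubling {ι : Type*} (χ : ι → ι → ι → SignType)
    (χ' : ι × Bool → ι × Bool → ι × Bool → SignType) (τ : ι → ι → Bool → SignType) : Prop where
  swap : ∀ x y z, χ' y x z = -χ' x y z
  rotate : ∀ x y z, χ' y z x = χ' x y z
  ne_zero : ∀ a b c, a ≠ b → a ≠ c → b ≠ c → χ a b c ≠ 0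
  far : ∀ a b c i j k, a ≠ b → a ≠ c → b ≠ c → χ' (a, i) (b, j) (c, k) = χ a b c
  near : ∀ a b j, a ≠ b → χ' (a, true) (a, false) (b, j) = -τ a b j
  side_ne_zero : ∀ a b j, a ≠ b → τ a b j ≠ 0
  not_mutual : ∀ a b, a ≠ b → τ a b true = τ a b false ∨ τ b a true = τ b a false

namespace IsDoubling

variable {ι : Type*} {χ : ι → ι → ι → SignType}
  {χ' : ι × Bool → ι × Bool → ι × Bool → SignType} {τ : ι → ι → Bool → SignType}

theorem self_left (h : IsDoubling χ χ' τ) (x z : ι × Bool) : χ' x x z = 0 := by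
  have := h.swap x x z
  revert this
  generalize χ' x x z = s
  revert s; decide

theorem self_outer (h : IsDoubling χ χ' τ) (x z : ι × Bool) : χ' x z x = 0 := by
  rw [h.rotate x x z, h.self_left]

theorem self_right (h : IsDoubling χ χ' τ) (x z : ι × Bool) : χ' z x x = 0 := by
  rw [h.rotate x z x, h.self_outer]

theorem swap_right (h : IsDoubling χ χ' τ) (x y z : ι × Bool) : χ' x z y = -χ' x y z := by
  rw [h.rotate y x z, h.swap]

theorem near' (h : IsDoubling χ χ' τ) {a b : ι} (hab : a ≠ b) (j : Bool) :
    χ' (a, false) (a, true) (b, j) = τ a b j := by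
  rw [h.swap, h.near a b j hab, neg_neg]

/-- The short edge between twins crosses nothing. An edge between copies of two other points sees
both twins on one side. Crossing another twin edge would require each pair to be separated by the
line of the other, against `not_mutual`. -/
theorem not_cross_of_eq_left (h : IsDoubling χ χ' τ) (a c d : ι) (i j k l : Bool) :
    ¬ ChiCross χ' (a, i) (a, j) (c, k) (d, l) := by
  rintro ⟨h1, h2⟩
  by_cases hij : i = j
  · subst hij; rw [h.self_left] at h1; simp at h1
  obtain rfl : j = !i := by cases i <;> cases j <;> simp_all
  by_cases hca : c = a
  · subst hca
    have : χ' (c, i) (c, !i) (c, k) = 0 := by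
      rcases Bool.eq_or_eq_not k i with rfl | rfl
      · exact h.self_outer _ _
      · exact h.self_right _ _
    rw [this] at h1; simp at h1
  by_cases hda : d = a
  · subst hda
    have : χ' (d, i) (d, !i) (d, l) = 0 := by
      rcases Bool.eq_or_eq_not l i with rfl | rfl
      · exact h.self_outer _ _
      · exact h.self_right _ _
    rw [this] at h1; simp at h1
  by_cases hcd : c = d
  · subst hcd
    by_cases hkl : k = l
    · subst hkl; rw [h.self_left] at h2; simp at h2
    obtain rfl : l = !k := by cases k <;> cases l <;> simp_all
    have hac : a ≠ c := Ne.symm hca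
    have hm := h.not_mutual a c hac
    cases i <;> cases k <;>
      simp only [Bool.not_true, Bool.not_false, h.near _ _ _ hac, h.near' hac, h.near _ _ _ hca,
        h.near' hca] at h1 h2 <;>
      generalize τ a c true = s1 at * <;> generalize τ a c false = s2 at * <;>
      generalize τ c a true = s3 at * <;> generalize τ c a false = s4 at * <;> clear h <;>
      revert s1 s2 s3 s4 <;> decide
  · rw [h.far _ _ _ _ _ _ hcd hca hda, h.far _ _ _ _ _ _ hcd hca hda] at h2
    revert h2
    generalize χ c d a = s
    revert s; decide

/-- The number of ways in which copies of `a b` cross copies of `c d`. -/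
def fiberCount (χ' : ι × Bool → ι × Bool → ι × Bool → SignType) (a b c d : ι) : ℕ :=
  ∑ i, ∑ j, ∑ k, ∑ l, if ChiCross χ' (a, i) (b, j) (c, k) (d, l) then 1 else 0

/-- The number of crossings of edges at distinct copies of `a` with edges leading to copies of
`b` and `d` (one half of it if `b = d`). -/
def localCount [DecidableEq ι] (τ : ι → ι → Bool → SignType) (a b d : ι) : ℕ :=
  if a = b ∨ a = d then 0
  else if b = d then
    if τ a b true = τ a b false ∧ τ b a true = τ b a false then 1 else 0
  else ∑ j, ∑ l, if τ a b j = τ a d l then 1 else 0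

theorem fiberCount_swap_right (h : IsDoubling χ χ' τ) (a b c d : ι) :
    fiberCount χ' a b d c = fiberCount χ' a b c d := by
  unfold fiberCount
  refine Finset.sum_congr rfl fun i _ => Finset.sum_congr rfl fun j _ => ?_
  rw [Finset.sum_comm]
  refine Finset.sum_congr rfl fun k _ => Finset.sum_congr rfl fun l _ => ?_
  exact if_congr ⟨fun H => H.swap_right h.swap, fun H => H.swap_right h.swap⟩ rfl rfl

theorem fiberCount_swap_left (h : IsDoubling χ χ' τ) (a b c d : ι) :
    fiberCount χ' b a c d = fiberCount χ' a b c d := by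
  unfold fiberCount
  rw [Finset.sum_comm]
  refine Finset.sum_congr rfl fun i _ => Finset.sum_congr rfl fun j _ => ?_
  refine Finset.sum_congr rfl fun k _ => Finset.sum_congr rfl fun l _ => ?_
  exact if_congr ⟨fun H => H.swap_left h.swap, fun H => H.swap_left h.swap⟩ rfl rfl

theorem fiberCount_eq_left (h : IsDoubling χ χ' τ) (a c d : ι) : fiberCount χ' a a c d = 0 := by
  simp [fiberCount, h.not_cross_of_eq_left]

theorem fiberCount_eq_right (h : IsDoubling χ χ' τ) (a b c : ι) : fiberCount χ' a b c c = 0 := by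
  simp only [fiberCount, Finset.sum_eq_zero_iff, ite_eq_right_iff, one_ne_zero, imp_false]
  intro i _ j _ k _ l _ H
  exact h.not_cross_of_eq_left c a b k l i j H.symm

/-- Only edges at distinct copies of `a` can cross. If the copies of `b` and `d` lie on the same
side of the line of `a`, exactly one of the two assignments of the copies of `a` crosses; otherwise
neither does. The remaining claim about signs is checked exhaustively. -/
theorem fiberCount_common [DecidableEq ι] (h : IsDoubling χ χ' τ) {a b d : ι} (hab : a ≠ b)
    (had : a ≠ d) (hbd : b ≠ d) : fiberCount χ' a b a d = localCount τ a b d := by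
  have e1 : ∀ i j k, χ' (a, i) (b, j) (a, k) = -χ' (a, i) (a, k) (b, j) :=
    fun i j k => h.swap_right _ _ _
  have e2 : ∀ i j k, χ' (a, k) (d, i) (b, j) = - χ a b d := by
    intro i j k; rw [h.swap_right, h.far _ _ _ _ _ _ hab had hbd]
  have e3 : ∀ i j k, χ' (a, k) (d, i) (a, j) = χ' (a, j) (a, k) (d, i) := by
    intro i j k; rw [h.rotate]
  have hs := h.ne_zero a b d hab had hbd
  have b1 := h.side_ne_zero a b true hab
  have b2 := h.side_ne_zero a b false hab
  have d1 := h.side_ne_zero a d true had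
  have d2 := h.side_ne_zero a d false had
  simp only [fiberCount, localCount, ChiCross, Fintype.sum_bool, e1, e2, e3, h.near _ _ _ hab,
    h.near' hab, h.near _ _ _ had, h.near' had, h.self_left, hab, had, hbd, or_self, if_false,
    h.far _ _ _ _ _ _ hab had hbd]
  clear e1 e2 e3 h
  generalize χ a b d = s at *
  generalize τ a b true = s1 at *
  generalize τ a b false = s2 at *
  generalize τ a d true = s3 at *
  generalize τ a d false = s4 at *
  revert s s1 s2 s3 s4
  decide

/-- Two edges without common endpoint between the twin pairs cross only if the four copies are in
convex position, that is, if neither line separates the other pair. Then one of the two perfect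
matchings crosses, seen in two orders. -/
theorem fiberCount_self [DecidableEq ι] (h : IsDoubling χ χ' τ) {a b : ι} (hab : a ≠ b) :
    fiberCount χ' a b a b = localCount τ a b b + localCount τ b a a := by
  have e1 : ∀ i j k, χ' (a, i) (b, j) (a, k) = -χ' (a, i) (a, k) (b, j) :=
    fun i j k => h.swap_right _ _ _
  have e2 : ∀ i j k, χ' (a, k) (b, i) (b, j) = χ' (b, i) (b, j) (a, k) :=
    fun i j k => (h.rotate _ _ _).symm
  have hba := hab.symm
  have b1 := h.side_ne_zero a b true hab
  have b2 := h.side_ne_zero a b false hab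
  have d1 := h.side_ne_zero b a true hba
  have d2 := h.side_ne_zero b a false hba
  have hm := h.not_mutual a b hab
  simp only [fiberCount, localCount, ChiCross, Fintype.sum_bool, e1, e2, h.near _ _ _ hab,
    h.near' hab, h.near _ _ _ hba, h.near' hba, h.self_left, hab, hba, or_self, if_false, if_true]
  clear e1 e2 h
  generalize τ a b true = s1 at *
  generalize τ a b false = s2 at *
  generalize τ b a true = s3 at *
  generalize τ b a false = s4 at *
  revert s1 s2 s3 s4
  decide

theorem fiberCount_of_ne [DecidableEq ι] (h : IsDoubling χ χ' τ) {a b c d : ι} (hab : a ≠ b)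
    (hac : a ≠ c) (had : a ≠ d) (hbc : b ≠ c) (hbd : b ≠ d) (hcd : c ≠ d) :
    fiberCount χ' a b c d = 16 * if ChiCross χ a b c d then 1 else 0 := by
  have : ∀ i j k l, ChiCross χ' (a, i) (b, j) (c, k) (d, l) ↔ ChiCross χ a b c d := by
    intro i j k l
    rw [ChiCross, ChiCross, h.far _ _ _ _ _ _ hab hac hbc, h.far _ _ _ _ _ _ hab had hbd,
      h.far _ _ _ _ _ _ hcd hac.symm had.symm, h.far _ _ _ _ _ _ hcd hbc.symm hbd.symm]
  simp only [fiberCount, this, Fintype.sum_bool]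
  ring

/-- Only an inequality is claimed, since `IsDoubling` leaves `χ` arbitrary on repeated indices,
where the first term may be positive. -/
theorem fiberCount_le [DecidableEq ι] (h : IsDoubling χ χ' τ) (a b c d : ι) :
    fiberCount χ' a b c d ≤ 16 * (if ChiCross χ a b c d then 1 else 0)
      + (if c = a then localCount τ a b d else 0) + (if d = a then localCount τ a b c else 0)
      + (if c = b then localCount τ b a d else 0) + (if d = b then localCount τ b a c else 0) := by
  by_cases hab : a = b
  · subst hab; rw [h.fiberCount_eq_left]; exact Nat.zero_le _
  by_cases hcd : c = d
  · subst hcd; rw [h.fiberCount_eq_right]; exact Nat.zero_le _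
  by_cases hac : c = a
  · subst hac
    by_cases hbd : d = b
    · subst hbd
      rw [h.fiberCount_self hab]
      simp only [if_true]
      omega
    · rw [h.fiberCount_common hab hcd (Ne.symm hbd)]
      simp only [if_true]
      omega
  by_cases had : d = a
  · subst had
    rw [h.fiberCount_swap_right]
    by_cases hbc : c = b
    · subst hbc
      rw [h.fiberCount_self hab]
      simp only [if_true]
      omega
    · rw [h.fiberCount_common hab (Ne.symm hac) (Ne.symm hbc)]
      simp only [if_true]
      omega
  by_cases hbc : c = b
  · subst hbc
    rw [h.fiberCount_swap_left, h.fiberCount_common (Ne.symm hab) hcd (Ne.symm had)]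
    simp only [if_true]
    omega
  by_cases hbd : d = b
  · subst hbd
    rw [h.fiberCount_swap_left, h.fiberCount_swap_right,
      h.fiberCount_common (Ne.symm hab) (Ne.symm hcd) (Ne.symm hac)]
    simp only [if_true]
    omega
  rw [h.fiberCount_of_ne hab (Ne.symm hac) (Ne.symm had) (Ne.symm hbc) (Ne.symm hbd) hcd]
  omega

theorem numCross_eq_sum_fiberCount [Fintype ι] :
    numCross χ' = ∑ a, ∑ b, ∑ c, ∑ d, fiberCount χ' a b c d := by
  simp only [numCross, fiberCount, Fintype.sum_prod_type, Fintype.sum_bool,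
    Finset.sum_add_distrib]

theorem numCross_le_localCount [Fintype ι] [DecidableEq ι] (h : IsDoubling χ χ' τ) :
    numCross χ' ≤ 16 * numCross χ + 4 * ∑ a, ∑ b, ∑ d, localCount τ a b d := by
  rw [numCross_eq_sum_fiberCount]
  refine (Finset.sum_le_sum fun a _ => Finset.sum_le_sum fun b _ => Finset.sum_le_sum fun c _ =>
    Finset.sum_le_sum fun d _ => h.fiberCount_le a b c d).trans_eq ?_
  simp only [Finset.sum_add_distrib, ← Finset.mul_sum]
  have e1 : ∑ a, ∑ b, ∑ c, ∑ d, (if c = a then localCount τ a b d else 0)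
      = ∑ a, ∑ b, ∑ d, localCount τ a b d := by
    refine Finset.sum_congr rfl fun a _ => Finset.sum_congr rfl fun b _ => ?_
    rw [Finset.sum_comm]
    simp
  have e2 : ∑ a, ∑ b, ∑ c, ∑ d, (if d = a then localCount τ a b c else 0)
      = ∑ a, ∑ b, ∑ d, localCount τ a b d := by
    simp
  have e3 : ∑ a, ∑ b, ∑ c, ∑ d, (if c = b then localCount τ b a d else 0)
      = ∑ a, ∑ b, ∑ d, localCount τ a b d := by
    rw [Finset.sum_comm]; exact e1
  have e4 : ∑ a, ∑ b, ∑ c, ∑ d, (if d = b then localCount τ b a c else 0)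
      = ∑ a, ∑ b, ∑ d, localCount τ a b d := by
    rw [Finset.sum_comm]; exact e2
  rw [e1, e2, e3, e4, numCross]
  ring

/-- Twice the value of `localCount`, in a form that is easy to sum. -/
theorem two_mul_localCount [DecidableEq ι] (h : IsDoubling χ χ' τ) (a b d : ι) :
    (2 * localCount τ a b d : ℤ) =
      4 * ((if b = a then 0 else 1) * (if d = a then 0 else 1))
      + (if b = a then 0 else (τ a b true : ℤ) + τ a b false) *
        (if d = a then 0 else (τ a d true : ℤ) + τ a d false)
      - (if d = b then 6 * (if b = a then 0 else 1)
        + 2 * (if b = a then 0 else if τ a b true = τ a b false then 1 else 0)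
        - 2 * (if a = b then 0 else if τ b a true = τ b a false then 1 else 0) else 0) := by
  by_cases hab : b = a
  · simp [localCount, hab]
  by_cases had : d = a
  · subst had
    simp [localCount, Ne.symm hab]
  have hab' : a ≠ b := Ne.symm hab
  have had' : a ≠ d := Ne.symm had
  have b1 := h.side_ne_zero a b true hab'
  have b2 := h.side_ne_zero a b false hab'
  by_cases hbd : d = b
  · subst hbd
    have d1 := h.side_ne_zero d a true hab
    have d2 := h.side_ne_zero d a false hab
    have hm := h.not_mutual a d hab'
    simp only [localCount, hab, hab', or_self, if_false, if_true]
    clear h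
    generalize τ a d true = s1 at *
    generalize τ a d false = s2 at *
    generalize τ d a true = s3 at *
    generalize τ d a false = s4 at *
    revert s1 s2 s3 s4
    decide
  · have d1 := h.side_ne_zero a d true had'
    have d2 := h.side_ne_zero a d false had'
    have hbd' : b ≠ d := Ne.symm hbd
    simp only [localCount, hab, hab', had, had', hbd, hbd', or_self, if_false, Fintype.sum_bool]
    clear h
    generalize τ a b true = s1 at *
    generalize τ a b false = s2 at *
    generalize τ a d true = s3 at *
    generalize τ a d false = s4 at *
    revert s1 s2 s3 s4
    decide

/-- For signs, twice the indicator of equality is `1 + s * t`. Hence, apart from the diagonal `b =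
d`, the sum over `b` and `d` is a constant plus the square of the imbalance at `a`, which `hbal`
kills. On the diagonal the correction is 6 plus a term antisymmetric in `a` and `b`, which cancels
in the total. -/
theorem two_mul_sum_localCount [Fintype ι] [DecidableEq ι] (h : IsDoubling χ χ' τ)
    (hbal : ∀ a, ∑ b, (if b = a then 0 else (τ a b true : ℤ) + τ a b false) = 0) :
    (2 * (∑ a, ∑ b, ∑ d, localCount τ a b d : ℕ) : ℤ) =
      Fintype.card ι * (4 * (Fintype.card ι - 1) ^ 2 - 6 * (Fintype.card ι - 1)) := by
  have hcard : ∀ a : ι, ∑ b, (if b = a then (0 : ℤ) else 1) = Fintype.card ι - 1 := by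
    intro a
    have : ∀ b : ι, (if b = a then (0 : ℤ) else 1) = 1 - if b = a then 1 else 0 := by
      intro b; split_ifs <;> simp
    simp [this, Finset.sum_sub_distrib]
  have hsym : ∑ a, ∑ b, (if a = b then (0 : ℤ) else if τ b a true = τ b a false then 1 else 0)
      = ∑ a, ∑ b, (if b = a then (0 : ℤ) else if τ a b true = τ a b false then 1 else 0) :=
    Finset.sum_comm
  push_cast
  simp only [Finset.mul_sum, h.two_mul_localCount]
  simp only [Finset.sum_sub_distrib, Finset.sum_add_distrib, ← Finset.mul_sum, ← Finset.sum_mul,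
    hbal, hcard, Finset.sum_ite_eq', Finset.mem_univ, if_true, hsym]
  simp
  ring

theorem numCross_le [Fintype ι] [DecidableEq ι] (h : IsDoubling χ χ' τ)
    (hbal : ∀ a, ∑ b, (if b = a then 0 else (τ a b true : ℤ) + τ a b false) = 0) :
    (numCross χ' : ℤ) ≤ 16 * numCross χ +
      Fintype.card ι * (8 * (Fintype.card ι - 1) ^ 2 - 12 * (Fintype.card ι - 1)) := by
  have h1 := h.numCross_le_localCount
  have h2 := h.two_mul_sum_localCount hbal
  zify at h1
  push_cast at h1 h2
  linarith


end IsDoubling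

/-! ### Line matchings and their inheritance -/

/-- Every point `a` is matched with a line through `a` and another point `f a` such that the
numbers of points on the two sides of this line differ by `k`, and distinct points are matched
with distinct lines. -/
structure IsLineMatching {ι : Type*} [Fintype ι] (χ : ι → ι → ι → SignType) (f : ι → ι)
    (k : ℤ) : Prop where
  ne : ∀ a, f a ≠ a
  no_two_cycle : ∀ a, f (f a) ≠ a
  sum_eq : ∀ a, ∑ r, (χ a (f a) r : ℤ) = k

/-- The copy `(a, false)` takes the splitting line through its twin, halving by `hbal`. The copy
`(a, true)` takes the line to a copy `g` of `f a`: points other than `a` and `f a` now count twice,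
giving `2 * k`, and the twins of the two endpoints contribute the other two terms of `hg`. So `hg`
says that some `g` makes this line halving. -/
theorem IsDoubling.exists_isLineMatching {ι : Type*} [Fintype ι] [DecidableEq ι]
    {χ : ι → ι → ι → SignType} {χ' : ι × Bool → ι × Bool → ι × Bool → SignType}
    {τ : ι → ι → Bool → SignType} (h : IsDoubling χ χ' τ)
    (hbal : ∀ a, ∑ b, (if b = a then 0 else (τ a b true : ℤ) + τ a b false) = 0)
    (hself : ∀ a b, χ a b a = 0 ∧ χ a b b = 0)
    {f : ι → ι} {k : ℤ} (hf : IsLineMatching χ f k)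
    (hg : ∀ a, ∃ g, 2 * k + (τ a (f a) g : ℤ) - (boolSign g * τ (f a) a true : SignType) = 0) :
    ∃ f', IsLineMatching χ' f' 0 := by
  choose g hg using hg
  refine ⟨fun x => if x.2 = true then (f x.1, g x.1) else (x.1, true), ?_, ?_, ?_⟩
  · rintro ⟨a, i⟩
    cases i
    · simp
    · simp [hf.ne]
  · rintro ⟨a, i⟩
    cases i
    · simp [hf.ne]
    · cases hga : g a
      · simp [hf.ne]
      · simp [hf.no_two_cycle]
  · rintro ⟨a, i⟩
    cases i
    · rw [Fintype.sum_prod_type, ← hbal a]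
      refine Finset.sum_congr rfl fun b _ => ?_
      by_cases hb : b = a
      · subst hb
        simp [h.self_right, h.self_outer]
      · simp [hb, h.near' (Ne.symm hb)]
    · have haf : a ≠ f a := Ne.symm (hf.ne a)
      have key : ∀ b, ∑ j, (χ' (a, true) (f a, g a) (b, j) : ℤ) = 2 * (χ a (f a) b : ℤ)
          + (if b = a then (τ a (f a) (g a) : ℤ) else 0)
          + (if b = f a then -((boolSign (g a) * τ (f a) a true : SignType) : ℤ) else 0) := by
        intro b
        by_cases hb : b = a
        · subst hb
          rw [Fintype.sum_bool, h.self_outer, h.swap_right, h.near _ _ _ haf]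
          simp [(hself _ _).1, haf]
        by_cases hb' : b = f a
        · have : ∑ j, (χ' (a, true) (f a, g a) (f a, j) : ℤ)
              = -((boolSign (g a) * τ (f a) a true : SignType) : ℤ) := by
            have e : ∀ i j, χ' (a, true) (f a, i) (f a, j) = χ' (f a, i) (f a, j) (a, true) :=
              fun i j => (h.rotate _ _ _).symm
            cases g a <;>
              simp [e, h.self_left, h.near _ _ _ haf.symm, h.near' haf.symm, boolSign]
          subst hb'
          rw [this, (hself _ _).2, if_neg hb, if_pos rfl]
          simp
        · simp [hb, hb', h.far _ _ _ _ _ _ haf (Ne.symm hb) (Ne.symm hb')]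
      simp only [if_true]
      rw [Fintype.sum_prod_type]
      simp only [key, Finset.sum_add_distrib, ← Finset.mul_sum, hf.sum_eq,
        Finset.sum_ite_eq', Finset.mem_univ, if_true]
      have := hg a
      linarith

/-! ### Geometric realisation: splitting points along halving lines -/

open Topology in
theorem eventually_sign_eq {f : ℝ → ℝ} (hf : Continuous f) (h0 : f 0 ≠ 0) :
    ∀ᶠ ε in 𝓝[>] (0 : ℝ), SignType.sign (f ε) = SignType.sign (f 0) := by
  have h := (continuousAt_sign_of_ne_zero h0).comp hf.continuousAt
  have h' : ∀ᶠ ε in 𝓝 (0 : ℝ), (SignType.sign ∘ f) ε ∈ ({SignType.sign (f 0)} : Set SignType) :=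
    h.eventually_mem ((isOpen_discrete _).mem_nhds (by simp))
  exact (h'.filter_mono nhdsWithin_le_nhds).mono fun ε hε => hε

/-- The family in which every point `p a` is replaced by the two points `p a ± ε • v a`. -/
noncomputable def splitPoints {ι : Type*} (p v : ι → Plane) (ε : ℝ) (x : ι × Bool) : Plane :=
  p x.1 + (((boolSign x.2 : SignType) : ℝ) * ε) • v x.1

/-- The side of the line through `p a` with direction `v a` on which `p b ± ε • v b` lies for
all small positive `ε`. -/
noncomputable def splitSide {ι : Type*} (p v : ι → Plane) (a b : ι) (j : Bool) : SignType :=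
  if cross (v a) (p b - p a) = 0 then boolSign j * SignType.sign (cross (v a) (v b))
  else SignType.sign (cross (v a) (p b - p a))

theorem continuous_orient_splitPoints {ι : Type*} (p v : ι → Plane) (x y z : ι × Bool) :
    Continuous fun ε => orient (splitPoints p v ε x) (splitPoints p v ε y)
      (splitPoints p v ε z) := by
  simp only [orient_eq, splitPoints, PiLp.add_apply, PiLp.smul_apply, smul_eq_mul]
  fun_prop

@[simp]
theorem splitPoints_zero {ι : Type*} (p v : ι → Plane) (x : ι × Bool) :
    splitPoints p v 0 x = p x.1 := by
  simp [splitPoints]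

theorem orient_splitPoints_pair {ι : Type*} (p v : ι → Plane) (ε : ℝ) (a b : ι) (j : Bool) :
    orient (splitPoints p v ε (a, true)) (splitPoints p v ε (a, false))
      (splitPoints p v ε (b, j)) = -(2 * ε) * (cross (v a) (p b - p a)
        + ((boolSign j : SignType) : ℝ) * ε * cross (v a) (v b)) := by
  simp only [orient_eq, cross, splitPoints, PiLp.add_apply, PiLp.sub_apply, PiLp.smul_apply,
    smul_eq_mul, boolSign, SignType.coe_one, SignType.coe_neg_one]
  ring

open Topology in
theorem eventually_chi_splitPoints_pair {ι : Type*} (p v : ι → Plane) (a b : ι) (j : Bool) :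
    ∀ᶠ ε in 𝓝[>] (0 : ℝ), chi (splitPoints p v ε) (a, true) (a, false) (b, j)
      = -splitSide p v a b j := by
  have hpos : ∀ᶠ ε in 𝓝[>] (0 : ℝ), 0 < ε := self_mem_nhdsWithin
  have hsign : ∀ ε : ℝ, 0 < ε → ∀ x : ℝ,
      SignType.sign (-(2 * ε) * x) = -SignType.sign x := by
    intro ε hε x
    rw [sign_mul, Left.sign_neg, sign_pos (by positivity)]
    simp
  by_cases h : cross (v a) (p b - p a) = 0
  · filter_upwards [hpos] with ε hε
    rw [chi, orient_splitPoints_pair, hsign ε hε, splitSide, if_pos h, h, zero_add, sign_mul,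
      sign_mul, sign_pos hε, mul_one]
    cases j <;> simp [boolSign]
  · have := eventually_sign_eq (f := fun ε => cross (v a) (p b - p a)
        + ((boolSign j : SignType) : ℝ) * ε * cross (v a) (v b)) (by fun_prop) (by simpa using h)
    filter_upwards [hpos, this] with ε hε h'
    rw [chi, orient_splitPoints_pair, hsign ε hε, splitSide, if_neg h, h']
    simp

/-- Every point `p a` is provided with a line of direction `v a` that halves the remaining points,
in such a way that no two of the lines coincide. -/
structure IsHalvingField {ι : Type*} [Fintype ι] (p v : ι → Plane) : Prop where
  ne_zero : ∀ a, v a ≠ 0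
  sum_eq : ∀ a, ∑ b, (SignType.sign (cross (v a) (p b - p a)) : ℤ) = 0
  not_mutual : ∀ a b, a ≠ b → cross (v a) (p b - p a) ≠ 0 ∨ cross (v b) (p a - p b) ≠ 0

theorem cross_eq_zero_trans {x y z : Plane} (hx : x ≠ 0) (hxy : cross x y = 0)
    (hxz : cross x z = 0) : cross y z = 0 := by
  have h : x 0 ≠ 0 ∨ x 1 ≠ 0 := by
    by_contra! hc
    exact hx (by ext i; fin_cases i <;> simp [hc])
  simp only [cross] at *
  rcases h with h | h
  · apply mul_left_cancel₀ h
    linear_combination z 0 * -hxy + y 0 * hxz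
  · apply mul_left_cancel₀ h
    linear_combination z 1 * -hxy + y 1 * hxz

theorem cross_neg_right (x y : Plane) : cross x (-y) = -cross x y := by
  simp [cross]; ring

/-- If `p b` lies on the line of `a` and `v b` is parallel to `v a`, the two lines coincide, which
`not_mutual` forbids. -/
theorem splitSide_ne_zero {ι : Type*} [Fintype ι] {p v : ι → Plane} (h : IsHalvingField p v)
    {a b : ι} (hab : a ≠ b) (j : Bool) : splitSide p v a b j ≠ 0 := by
  rw [splitSide]
  split_ifs with h0
  · have hne : cross (v a) (v b) ≠ 0 := by
      intro hv
      refine ((h.not_mutual a b hab).resolve_left (not_not.2 h0)) ?_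
      rw [← neg_sub, cross_neg_right, neg_eq_zero]
      exact cross_eq_zero_trans (h.ne_zero a) hv h0
    rw [← sign_ne_zero] at hne
    revert hne
    generalize SignType.sign (cross (v a) (v b)) = s
    revert s j; decide
  · exact sign_ne_zero.2 h0

/-- A point off the line passes its side to both copies; the copies of a point on the line fall on
opposite sides and cancel. -/
theorem sum_splitSide {ι : Type*} [Fintype ι] [DecidableEq ι] {p v : ι → Plane}
    (h : IsHalvingField p v) (a : ι) :
    ∑ b, (if b = a then 0 else (splitSide p v a b true : ℤ) + splitSide p v a b false) = 0 := by
  have := h.sum_eq a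
  have h2 : 2 * ∑ b, (SignType.sign (cross (v a) (p b - p a)) : ℤ) = 0 := by rw [this, mul_zero]
  rw [Finset.mul_sum] at h2
  refine Eq.trans ?_ h2
  refine Finset.sum_congr rfl fun b _ => ?_
  split_ifs with hb
  · subst hb
    simp [cross]
  · simp only [splitSide]
    split_ifs with h0
    · simp [h0, boolSign]
    · ring

open Topology in
theorem eventually_isDoubling {ι : Type*} [Fintype ι] {p v : ι → Plane} (hp : Generic p)
    (h : IsHalvingField p v) :
    ∀ᶠ ε in 𝓝[>] (0 : ℝ), IsDoubling (chi p) (chi (splitPoints p v ε)) (splitSide p v) := by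
  have h1 : ∀ᶠ ε in 𝓝[>] (0 : ℝ), ∀ a b c i j k, a ≠ b → a ≠ c → b ≠ c →
      chi (splitPoints p v ε) (a, i) (b, j) (c, k) = chi p a b c := by
    simp only [eventually_all]
    intro a b c i j k hab hac hbc
    have := eventually_sign_eq (continuous_orient_splitPoints p v (a, i) (b, j) (c, k))
      (by simpa [chi] using hp a b c hab hac hbc)
    simpa only [splitPoints_zero, chi] using this
  have h2 : ∀ᶠ ε in 𝓝[>] (0 : ℝ), ∀ a b j,
      chi (splitPoints p v ε) (a, true) (a, false) (b, j) = -splitSide p v a b j := by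
    simp only [eventually_all]
    exact eventually_chi_splitPoints_pair p v
  filter_upwards [h1, h2] with ε h1 h2
  refine ⟨chi_swap _, chi_rotate _, hp, h1, fun a b j _ => h2 a b j,
    fun a b j hab => splitSide_ne_zero h hab j, ?_⟩
  intro a b hab
  rcases h.not_mutual a b hab with h0 | h0
  · left; simp [splitSide, h0]
  · right; simp [splitSide, h0]

theorem IsDoubling.generic {ι : Type*} {χ : ι → ι → ι → SignType} {q : ι × Bool → Plane}
    {τ : ι → ι → Bool → SignType} (h : IsDoubling χ (chi q) τ) : Generic q := by
  have key : ∀ a i j b k, i ≠ j → a ≠ b → chi q (a, i) (a, j) (b, k) ≠ 0 := by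
    intro a i j b k hij hab
    have := h.side_ne_zero a b k hab
    cases i <;> cases j <;> first | exact absurd rfl hij | skip
    · rwa [h.near' hab]
    · rw [h.near _ _ _ hab]
      revert this
      generalize τ a b k = s
      revert s; decide
  rintro ⟨a, i⟩ ⟨b, j⟩ ⟨c, k⟩ h1 h2 h3
  by_cases hab : a = b
  · subst hab
    have hij : i ≠ j := by rintro rfl; exact h1 rfl
    by_cases hac : a = c
    · subst hac
      exfalso
      have hik : i ≠ k := by rintro rfl; exact h2 rfl
      have hjk : j ≠ k := by rintro rfl; exact h3 rfl
      revert hij hik hjk; clear h1 h2 h3; revert i j k; decide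
    · exact key a i j c k hij hac
  by_cases hac : a = c
  · subst hac
    rw [← chi_rotate, ← chi_rotate]
    exact key a k i b j (by rintro rfl; exact h2 rfl) hab
  by_cases hbc : b = c
  · subst hbc
    rw [← chi_rotate]
    exact key b j k a i (by rintro rfl; exact h3 rfl) (Ne.symm hab)
  rw [h.far _ _ _ _ _ _ hab hac hbc]
  exact h.ne_zero a b c hab hac hbc

theorem chi_self_outer {ι : Type*} (p : ι → Plane) (a b : ι) : chi p a b a = 0 := by
  simp [chi]

theorem chi_self_right {ι : Type*} (p : ι → Plane) (a b : ι) : chi p a b b = 0 := by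
  simp [chi]

/-- Splitting every point along a halving line. -/
theorem exists_doubling {ι : Type*} [Fintype ι] [DecidableEq ι] {p v : ι → Plane}
    (hp : Generic p) (hv : IsHalvingField p v) {f : ι → ι} {k : ℤ}
    (hf : IsLineMatching (chi p) f k)
    (hg : ∀ a, ∃ g, 2 * k + (splitSide p v a (f a) g : ℤ)
      - (boolSign g * splitSide p v (f a) a true : SignType) = 0) :
    ∃ (q : ι × Bool → Plane) (f' : ι × Bool → ι × Bool), Generic q ∧
      IsLineMatching (chi q) f' 0 ∧ (numCross (chi q) : ℤ) ≤ 16 * numCross (chi p) +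
        Fintype.card ι * (8 * (Fintype.card ι - 1) ^ 2 - 12 * (Fintype.card ι - 1)) := by
  obtain ⟨ε, h⟩ := (eventually_isDoubling hp hv).exists
  obtain ⟨f', hf'⟩ := h.exists_isLineMatching (sum_splitSide hv)
    (fun a b => ⟨chi_self_outer p a b, chi_self_right p a b⟩) hf hg
  exact ⟨splitPoints p v ε, f', h.generic, hf', h.numCross_le (sum_splitSide hv)⟩

/-- A family with a matching by halving lines through two points can be doubled. -/
theorem exists_doubling_of_even {ι : Type*} [Fintype ι] [DecidableEq ι] {p : ι → Plane}
    (hp : Generic p) (hinj : Function.Injective p) {f : ι → ι}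
    (hf : IsLineMatching (chi p) f 0) :
    ∃ (q : ι × Bool → Plane) (f' : ι × Bool → ι × Bool), Generic q ∧
      IsLineMatching (chi q) f' 0 ∧ (numCross (chi q) : ℤ) ≤ 16 * numCross (chi p) +
        Fintype.card ι * (8 * (Fintype.card ι - 1) ^ 2 - 12 * (Fintype.card ι - 1)) := by
  have hcr : ∀ a b, cross (p (f a) - p a) (p b - p a) = 0 → a ≠ b → b = f a := by
    intro a b h hab
    by_contra hb
    exact hp a (f a) b (hf.ne a).symm hab (Ne.symm hb) (by simp [chi, orient, h])
  have hv : IsHalvingField p fun a => p (f a) - p a := by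
    refine ⟨fun a => sub_ne_zero.2 fun h => hf.ne a (hinj h), hf.sum_eq, ?_⟩
    intro a b hab
    by_contra! h
    have h1 := hcr a b h.1 hab
    have h2 := hcr b a h.2 hab.symm
    exact hf.no_two_cycle a (by rw [← h1, ← h2])
  -- With `k = 0` and `g = true` the two sides must agree. They do: `p (f a)` lies on the line of
  -- `a`, so its copy is placed by the sign of `cross (v a) (v (f a))`, and `e3` identifies this
  -- with the side of `a` for the line of `f a`.
  refine exists_doubling hp hv hf fun a => ⟨true, ?_⟩
  have e1 : cross (p (f a) - p a) (p (f a) - p a) = 0 := by simp [cross]; ring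
  have e2 : cross (p (f (f a)) - p (f a)) (p a - p (f a)) ≠ 0 :=
    (hv.not_mutual a (f a) (hf.ne a).symm).resolve_left (not_not.2 e1)
  have e3 : cross (p (f (f a)) - p (f a)) (p a - p (f a))
      = cross (p (f a) - p a) (p (f (f a)) - p (f a)) := by simp [cross]; ring
  simp only [splitSide, e1, e3, if_true]
  rw [e3] at e2
  simp [e2, boolSign]

/-- The vector `x` rotated by a right angle. -/
noncomputable def rot (x : Plane) : Plane := !₂[-x 1, x 0]

open Topology in
/-- A family in which every point lies on a line through two points that only just fails to halve
the remaining points can be doubled. -/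
theorem exists_doubling_of_odd {ι : Type*} [Fintype ι] [DecidableEq ι] {p : ι → Plane}
    (hp : Generic p) (hinj : Function.Injective p) {f : ι → ι}
    (hf : IsLineMatching (chi p) f 1) :
    ∃ (q : ι × Bool → Plane) (f' : ι × Bool → ι × Bool), Generic q ∧
      IsLineMatching (chi q) f' 0 ∧ (numCross (chi q) : ℤ) ≤ 16 * numCross (chi p) +
        Fintype.card ι * (8 * (Fintype.card ι - 1) ^ 2 - 12 * (Fintype.card ι - 1)) := by
  set w : ι → Plane := fun a => p (f a) - p a with hw
  have hpos : ∀ᶠ δ in 𝓝[>] (0 : ℝ), 0 < δ := self_mem_nhdsWithin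
  have hev : ∀ᶠ δ in 𝓝[>] (0 : ℝ), ∀ a b, a ≠ b → b ≠ f a →
      SignType.sign (cross (w a + δ • rot (w a)) (p b - p a)) = chi p a (f a) b := by
    simp only [eventually_all]
    intro a b hab hb
    have := eventually_sign_eq
      (f := fun δ : ℝ => cross (w a + δ • rot (w a)) (p b - p a))
      (by simp only [cross, PiLp.add_apply, PiLp.smul_apply, smul_eq_mul]; fun_prop)
      (by simpa [chi, orient] using hp a (f a) b (hf.ne a).symm hab hb.symm)
    simpa [chi, orient] using this
  obtain ⟨δ, hδ, hev⟩ := (hpos.and hev).exists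
  set v : ι → Plane := fun a => w a + δ • rot (w a) with hvdef
  have hwpos : ∀ a, 0 < w a 0 ^ 2 + w a 1 ^ 2 := by
    intro a
    have hne : w a ≠ 0 := sub_ne_zero.2 fun h => hf.ne a (hinj h)
    by_contra! hc
    apply hne
    ext i
    fin_cases i
    · simp; nlinarith [sq_nonneg (w a 0), sq_nonneg (w a 1)]
    · simp; nlinarith [sq_nonneg (w a 0), sq_nonneg (w a 1)]
  -- The counterclockwise rotation leaves `f a` on the negative side, which offsets the imbalance
  -- `1`; all other points keep their sides.
  have hvf : ∀ a, SignType.sign (cross (v a) (p (f a) - p a)) = -1 := by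
    intro a
    have : cross (v a) (p (f a) - p a) = -(δ * (w a 0 ^ 2 + w a 1 ^ 2)) := by
      change cross (w a + δ • rot (w a)) (w a) = _
      simp [cross, rot]; ring
    rw [this, sign_eq_neg_one_iff, neg_lt_zero]
    exact mul_pos hδ (hwpos a)
  have hne0 : ∀ a b, a ≠ b → cross (v a) (p b - p a) ≠ 0 := by
    intro a b hab
    rw [← sign_ne_zero]
    by_cases hb : b = f a
    · rw [hb, hvf]; decide
    · rw [hev a b hab hb]
      exact hp a (f a) b (hf.ne a).symm hab (Ne.symm hb)
  have hv : IsHalvingField p v := by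
    refine ⟨?_, ?_, fun a b hab => Or.inl (hne0 a b hab)⟩
    · intro a h
      have := hvf a
      simp [h, cross] at this
    · intro a
      have : ∀ b, (SignType.sign (cross (v a) (p b - p a)) : ℤ)
          = (chi p a (f a) b : ℤ) + if b = f a then -1 else 0 := by
        intro b
        by_cases hb : b = f a
        · subst hb; simp [hvf, chi_self_right]
        by_cases hab : b = a
        · subst hab; simp [chi_self_outer, hb, cross]
        · rw [hev a b (Ne.symm hab) hb]; simp [hb]
      simp [this, Finset.sum_add_distrib, hf.sum_eq]
  refine exists_doubling hp hv hf fun a => ?_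
  have haf := (hf.ne a).symm
  have h1 := hvf a
  have h2 := sign_ne_zero.2 (hne0 _ _ haf.symm)
  simp only [splitSide, hne0 _ _ haf, hne0 _ _ haf.symm, if_false, h1]
  -- The condition reads `2 - 1 - boolSign g * s = 0`, so `g` is the copy whose sign is `s`.
  revert h2
  generalize SignType.sign (cross (v (f a)) (p a - p (f a))) = s
  revert s; decide

/-! ### Almost halving lines through two points of an odd set -/

/-- A discrete intermediate value argument: in the order of `κ`, the partial sums of `e` move by
`±1` from 0 to the even number `T`, so some partial sum, with its last term `e i` included, equals
`T / 2`. -/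
theorem exists_balanced_of_sum_nonneg {ι : Type*} (s : Finset ι) (κ : ι → ℝ)
    (hκ : Set.InjOn κ s) (e : ι → ℤ) (he : ∀ i ∈ s, e i = 1 ∨ e i = -1) (hs : s.Nonempty)
    (hcard : Even s.card) (hT : 0 ≤ ∑ r ∈ s, e r) :
    ∃ i ∈ s, ∑ r ∈ s, e r = 2 * ∑ r ∈ s with κ r < κ i, e r + 2 * e i := by
  classical
  have heven : (2 : ℤ) ∣ ∑ r ∈ s, e r := by
    have h1 : (2 : ℤ) ∣ ∑ r ∈ s, (e r + 1) := by
      refine Finset.dvd_sum fun i hi => ?_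
      rcases he i hi with h | h <;> simp [h]
    rw [Finset.sum_add_distrib] at h1
    have h2 : (2 : ℤ) ∣ s.card := by exact_mod_cast hcard.two_dvd
    simp only [Finset.sum_const, nsmul_eq_mul, mul_one] at h1
    exact (dvd_add_left h2).1 h1
  set T := ∑ r ∈ s, e r with hTdef
  have hfil : ∀ i ∈ s, ∀ r ∈ s, (∀ x ∈ s, κ x < κ i → κ x ≤ κ r) → κ r < κ i →
      ∑ x ∈ s with κ x < κ i, e x = e r + ∑ x ∈ s with κ x < κ r, e x := by
    intro i hi r hr hmax hlt
    rw [← Finset.sum_insert (by simp)]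
    refine Finset.sum_congr ?_ fun _ _ => rfl
    ext x
    simp only [Finset.mem_filter, Finset.mem_insert]
    constructor
    · rintro ⟨hx, hxi⟩
      rcases (hmax x hx hxi).lt_or_eq with h | h
      · exact Or.inr ⟨hx, h⟩
      · exact Or.inl (hκ hx hr h)
    · rintro (rfl | ⟨hx, h⟩)
      · exact ⟨hr, hlt⟩
      · exact ⟨hx, h.trans hlt⟩
  obtain ⟨l, hl, hlmax⟩ := s.exists_max_image κ hs
  have hlast : T = ∑ r ∈ s with κ r < κ l, e r + e l := by
    rw [hTdef, ← Finset.sum_erase_add s e hl]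
    congr 1
    refine Finset.sum_congr ?_ fun _ _ => rfl
    ext x
    simp only [Finset.mem_erase, Finset.mem_filter]
    constructor
    · rintro ⟨hne, hx⟩
      exact ⟨hx, lt_of_le_of_ne (hlmax x hx) fun h => hne (hκ hx hl h)⟩
    · rintro ⟨hx, h⟩
      exact ⟨by rintro rfl; exact lt_irrefl _ h, hx⟩
  rcases hT.eq_or_lt with h0 | hT
  -- If `T = 0`, the full sum already equals `T / 2`.
  · exact ⟨l, hl, by linarith⟩
  -- The first index at which the partial sum reaches `T / 2`; before it the sum is strictly
  -- smaller, so a step of size one hits `T / 2` exactly.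
  set B := s.filter fun i => T ≤ 2 * ∑ r ∈ s with κ r < κ i, e r + 2 * e i with hB
  have hBne : B.Nonempty := ⟨l, by rw [hB, Finset.mem_filter]; exact ⟨hl, by linarith⟩⟩
  obtain ⟨i, hiB, himin⟩ := B.exists_min_image κ hBne
  obtain ⟨hi, hile⟩ := Finset.mem_filter.1 hiB
  refine ⟨i, hi, ?_⟩
  have hpos : 2 * ∑ r ∈ s with κ r < κ i, e r < T := by
    rcases (s.filter fun r => κ r < κ i).eq_empty_or_nonempty with h | h
    · rw [h]; simpa using hT
    · obtain ⟨r, hr, hrmax⟩ := Finset.exists_max_image _ κ h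
      obtain ⟨hrs, hri⟩ := Finset.mem_filter.1 hr
      rw [hfil i hi r hrs (fun x hx hxi => hrmax x (by simp [hx, hxi])) hri]
      by_contra! hcon
      have := himin r (by rw [hB, Finset.mem_filter]; exact ⟨hrs, by linarith⟩)
      linarith
  obtain ⟨k, hk⟩ := heven
  rcases he i hi with h | h <;> omega

theorem exists_balanced {ι : Type*} (s : Finset ι) (κ : ι → ℝ)
    (hκ : Set.InjOn κ s) (e : ι → ℤ) (he : ∀ i ∈ s, e i = 1 ∨ e i = -1) (hs : s.Nonempty)
    (hcard : Even s.card) :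
    ∃ i ∈ s, ∑ r ∈ s, e r = 2 * ∑ r ∈ s with κ r < κ i, e r + 2 * e i := by
  rcases le_total 0 (∑ r ∈ s, e r) with h | h
  · exact exists_balanced_of_sum_nonneg s κ hκ e he hs hcard h
  · obtain ⟨i, hi, h'⟩ := exists_balanced_of_sum_nonneg s κ hκ (fun i => -e i)
      (fun i hi => by rcases he i hi with h | h <;> simp [h]) hs hcard
      (by simpa using h)
    refine ⟨i, hi, ?_⟩
    simp only [Finset.sum_neg_distrib] at h'
    linarith

/-- Among an even number of lines through the origin, directed arbitrarily, there is one such that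
the numbers of directions to its left and to its right differ by exactly one. -/
theorem exists_sum_sign_cross_eq_one {ι : Type*} (s : Finset ι) (w : ι → Plane)
    (h0 : ∀ i ∈ s, w i ≠ 0) (hw : ∀ i ∈ s, ∀ j ∈ s, i ≠ j → cross (w i) (w j) ≠ 0)
    (hs : s.Nonempty) (hcard : Even s.card) :
    ∃ i ∈ s, ∑ r ∈ s, (SignType.sign (cross (w i) (w r)) : ℤ) = 1 := by
  classical
  -- A value of `t` for which the linear form `w 1 + t * w 0` vanishes at none of the given vectors.
  -- Its sign records which way each line is directed, while `κ` orders the undirected lines by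
  -- slope.
  obtain ⟨t, ht⟩ := Set.infinite_univ.exists_notMem_finset (s.image fun i => -(w i 1) / w i 0)
  obtain ⟨-, ht⟩ := ht
  set y : ι → ℝ := fun i => w i 1 + t * w i 0 with hy
  have hy0 : ∀ i ∈ s, y i ≠ 0 := by
    intro i hi h
    by_cases hx : w i 0 = 0
    · apply h0 i hi
      have h1 : w i 1 = 0 := by simpa [hy, hx] using h
      ext j
      fin_cases j
      · simpa using hx
      · simpa using h1
    · apply ht
      rw [Finset.mem_image]
      refine ⟨i, hi, ?_⟩
      rw [div_eq_iff hx]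
      simp only [hy] at h
      linarith
  set κ : ι → ℝ := fun i => -(w i 0 / y i) with hκdef
  have hcross : ∀ i ∈ s, ∀ r ∈ s, cross (w i) (w r) = y i * y r * (κ r - κ i) := by
    intro i hi r hr
    have h1 := hy0 i hi
    have h2 := hy0 r hr
    simp only [hκdef]
    field_simp
    simp only [cross, hy]
    ring
  have hκ : Set.InjOn κ s := by
    intro i hi j hj hij
    by_contra hne
    apply hw i hi j hj hne
    rw [hcross i hi j hj, hij]
    ring
  obtain ⟨i, hi, h⟩ := exists_balanced s κ hκ (fun i => (SignType.sign (y i) : ℤ)) (by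
    intro i hi
    rcases lt_or_gt_of_ne (hy0 i hi) with h | h
    · right; simp [sign_neg h]
    · left; simp [sign_pos h]) hs hcard
  refine ⟨i, hi, ?_⟩
  have hsq : (SignType.sign (y i) : ℤ) * SignType.sign (y i) = 1 := by
    rcases lt_or_gt_of_ne (hy0 i hi) with h | h
    · simp [sign_neg h]
    · simp [sign_pos h]
  have hterm : ∀ r ∈ s, (SignType.sign (cross (w i) (w r)) : ℤ) =
      SignType.sign (y i) * ((SignType.sign (y r) : ℤ)
        - 2 * (if κ r < κ i then (SignType.sign (y r) : ℤ) else 0)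
        - if r = i then (SignType.sign (y r) : ℤ) else 0) := by
    intro r hr
    rw [hcross i hi r hr, sign_mul, sign_mul]
    rcases lt_trichotomy (κ r) (κ i) with hlt | heq | hgt
    · have hne : r ≠ i := by rintro rfl; exact lt_irrefl _ hlt
      simp [hlt, hne, sign_neg (sub_neg.2 hlt)]
      ring
    · have : r = i := hκ hr hi heq
      subst this
      simp
    · have hne : r ≠ i := by rintro rfl; exact lt_irrefl _ hgt
      simp [hgt.not_gt, hne, sign_pos (sub_pos.2 hgt)]
  -- With `e` the sign of `y`, `T` its total and `S` the sum over smaller slopes, the sum is `e i *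
  -- (T - 2 * S - e i)`, and `T = 2 * S + 2 * e i` turns it into `e i * e i = 1`.
  rw [Finset.sum_congr rfl hterm, ← Finset.mul_sum, Finset.sum_sub_distrib,
    Finset.sum_sub_distrib, ← Finset.mul_sum, ← Finset.sum_filter, Finset.sum_ite_eq', if_pos hi, h]
  linear_combination hsq

theorem exists_isLineMatching_of_odd {ι : Type*} [Fintype ι] {p : ι → Plane} (hp : Generic p)
    (hinj : Function.Injective p) (hodd : Odd (Fintype.card ι)) (h1 : 1 < Fintype.card ι) :
    ∃ f, IsLineMatching (chi p) f 1 := by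
  classical
  have key : ∀ a, ∃ b, b ≠ a ∧ ∑ r, (chi p a b r : ℤ) = 1 := by
    intro a
    have hc : (Finset.univ.erase a).card = Fintype.card ι - 1 := by simp
    obtain ⟨b, hb, h⟩ := exists_sum_sign_cross_eq_one (Finset.univ.erase a) (fun b => p b - p a)
      (fun i hi => sub_ne_zero.2 fun h => (Finset.ne_of_mem_erase hi) (hinj h))
      (fun i hi j hj hij => by
        have := hp a i j (Finset.ne_of_mem_erase hi).symm (Finset.ne_of_mem_erase hj).symm hij
        simpa [chi, orient] using this)
      (Finset.card_pos.1 (by omega))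
      (by rw [hc]; exact hodd.tsub_odd odd_one)
    refine ⟨b, Finset.ne_of_mem_erase hb, ?_⟩
    rw [← Finset.add_sum_erase _ _ (Finset.mem_univ a), chi_self_outer]
    simpa [chi, orient] using h
  choose f hne hf using key
  -- In a two-cycle the same line would be used in both directions, and its signed sum would be both
  -- `1` and `-1`.
  refine ⟨f, hne, fun a h => ?_, hf⟩
  have h2 := hf (f a)
  rw [h] at h2
  have h3 : ∑ r, (chi p (f a) a r : ℤ) = -∑ r, (chi p a (f a) r : ℤ) := by
    rw [← Finset.sum_neg_distrib]
    refine Finset.sum_congr rfl fun r _ => ?_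
    rw [chi_swap]; simp
  rw [h2, hf a] at h3
  omega

/-! ### Monotonicity of the crossing density -/

open Classical in
/-- The ordered quadruples of points of `S` that witness a crossing. -/
noncomputable def crossQuadruples (S : Finset Plane) : Finset (Plane × Plane × Plane × Plane) :=
  (S ×ˢ S ×ˢ S ×ˢ S).filter (fun t => ChiCross (chi id) t.1 t.2.1 t.2.2.1 t.2.2.2)

open Classical in
theorem card_endpoints_of_mem_crossQuadruples {S : Finset Plane}
    {t : Plane × Plane × Plane × Plane} (ht : t ∈ crossQuadruples S) :
    ({t.1, t.2.1, t.2.2.1, t.2.2.2} : Finset Plane) ⊆ S ∧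
      ({t.1, t.2.1, t.2.2.1, t.2.2.2} : Finset Plane).card = 4 := by
  obtain ⟨a, b, c, d⟩ := t
  simp only [crossQuadruples, Finset.mem_filter, Finset.mem_product] at ht
  obtain ⟨⟨ha, hb, hc, hd⟩, hX⟩ := ht
  obtain ⟨h1, h2, h3, h4, h5, h6⟩ := hX.pairwise_ne
  refine ⟨by simp [Finset.insert_subset_iff, ha, hb, hc, hd], ?_⟩
  rw [Finset.card_insert_of_notMem (by simp [h1, h3, h4]),
    Finset.card_insert_of_notMem (by simp [h5, h6]), Finset.card_pair h2]

theorem InGeneralPosition.mono {S T : Finset Plane} (hT : InGeneralPosition T) (h : S ⊆ T) :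
    InGeneralPosition S :=
  fun p hp q hq r hr => hT p (h hp) q (h hq) r (h hr)

theorem crossings_eq_zero_of_card_lt {S : Finset Plane} (hS : InGeneralPosition S)
    (h : S.card < 4) : crossings S = 0 := by
  classical
  have h8 : (crossQuadruples S).card = 8 * crossings S := card_filter_chiCross hS
  have : crossQuadruples S = ∅ := by
    rw [Finset.eq_empty_iff_forall_notMem]
    intro t ht
    obtain ⟨hsub, hc⟩ := card_endpoints_of_mem_crossQuadruples ht
    have := Finset.card_le_card hsub
    omega
  rw [this, Finset.card_empty] at h8
  omega

-- A crossing has four endpoints and survives the deletion of any other point.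
open Classical in
theorem sum_crossings_erase {S : Finset Plane} (hS : InGeneralPosition S) :
    ∑ x ∈ S, crossings (S.erase x) = (S.card - 4) * crossings S := by
  have h8 : (crossQuadruples S).card = 8 * crossings S := card_filter_chiCross hS
  have h8' : ∀ x ∈ S, 8 * crossings (S.erase x) =
      ∑ t ∈ crossQuadruples S,
        if x ∉ ({t.1, t.2.1, t.2.2.1, t.2.2.2} : Finset Plane) then 1 else 0 := by
    intro x _
    rw [← card_filter_chiCross (hS.mono (Finset.erase_subset x S)), ← Finset.card_filter]
    congr 1
    ext ⟨a, b, c, d⟩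
    simp only [crossQuadruples, Finset.mem_filter, Finset.mem_product, Finset.mem_erase,
      Finset.mem_insert, Finset.mem_singleton, not_or, ne_comm (b := x)]
    tauto
  have key : ∑ x ∈ S, 8 * crossings (S.erase x) = 8 * ((S.card - 4) * crossings S) := by
    rw [Finset.sum_congr rfl h8', Finset.sum_comm]
    have : ∀ t ∈ crossQuadruples S,
        (∑ x ∈ S, if x ∉ ({t.1, t.2.1, t.2.2.1, t.2.2.2} : Finset Plane) then 1 else 0)
          = S.card - 4 := by
      intro t ht
      obtain ⟨hsub, hc⟩ := card_endpoints_of_mem_crossQuadruples ht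
      rw [← Finset.card_filter, ← Finset.sdiff_eq_filter, Finset.card_sdiff_of_subset hsub, hc]
    rw [Finset.sum_congr rfl this, Finset.sum_const, h8, smul_eq_mul]
    ring
  rw [← Finset.mul_sum] at key
  omega

theorem rectilinearCrossingNumber_le {S : Finset Plane} (hS : InGeneralPosition S) :
    rectilinearCrossingNumber S.card ≤ crossings S :=
  Nat.sInf_le ⟨S, rfl, hS, rfl⟩

theorem rectilinearCrossingNumber_eq_zero {n : ℕ} (hn : n < 4) :
    rectilinearCrossingNumber n = 0 := by
  obtain ⟨S, rfl, hS, h⟩ := exists_crossings_eq_rectilinearCrossingNumber n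
  rw [← h, crossings_eq_zero_of_card_lt hS hn]

theorem succ_mul_rectilinearCrossingNumber_le (n : ℕ) :
    (n + 1) * rectilinearCrossingNumber n ≤ (n + 1 - 4) * rectilinearCrossingNumber (n + 1) := by
  classical
  obtain ⟨S, hc, hS, h⟩ := exists_crossings_eq_rectilinearCrossingNumber (n + 1)
  rw [← h, ← hc, ← sum_crossings_erase hS, ← smul_eq_mul]
  refine Finset.card_nsmul_le_sum _ _ _ fun x hx => ?_
  have := rectilinearCrossingNumber_le (hS.mono (Finset.erase_subset x S))
  rwa [Finset.card_erase_of_mem hx, hc, Nat.add_sub_cancel] at this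

/-- The crossing density is monotone in the number of points. -/
theorem rectilinearCrossingNumber_mul_choose_le {n N : ℕ} (hn : 4 ≤ n) (hN : n ≤ N) :
    rectilinearCrossingNumber n * N.choose 4 ≤ rectilinearCrossingNumber N * n.choose 4 := by
  induction N, hN using Nat.le_induction with
  | base => rfl
  | succ N hN ih =>
    have h1 := Nat.choose_mul_succ_eq N 4
    have h2 := succ_mul_rectilinearCrossingNumber_le N
    refine le_of_mul_le_mul_left (a := N + 1 - 4) ?_
      (show 0 < N + 1 - 4 by omega)
    calc (N + 1 - 4) * (rectilinearCrossingNumber n * (N + 1).choose 4)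
        = rectilinearCrossingNumber n * ((N + 1).choose 4 * (N + 1 - 4)) := by ring
      _ = (N + 1) * (rectilinearCrossingNumber n * N.choose 4) := by rw [← h1]; ring
      _ ≤ (N + 1) * (rectilinearCrossingNumber N * n.choose 4) := Nat.mul_le_mul_left _ ih
      _ = ((N + 1) * rectilinearCrossingNumber N) * n.choose 4 := by ring
      _ ≤ ((N + 1 - 4) * rectilinearCrossingNumber (N + 1)) * n.choose 4 :=
        Nat.mul_le_mul_right _ h2
      _ = (N + 1 - 4) * (rectilinearCrossingNumber (N + 1) * n.choose 4) := by ring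

/-! ### Iterated doubling and passage to the limit -/

/-- The quantity `24 cr + 3 n ^ 3 - 7 n ^ 2 + 30 n / 7`, where `8 cr = x`, which is multiplied by at
most `16` when `n` points are doubled along halving lines. -/
noncomputable def doublingPotential (x n : ℝ) : ℝ := 3 * x + 3 * n ^ 3 - 7 * n ^ 2 + (30 / 7) * n

theorem exists_iterated_doubling {ι : Type} [Fintype ι] {p : ι → Plane} (hp : Generic p)
    (hodd : Odd (Fintype.card ι)) (h1 : 1 < Fintype.card ι) (j : ℕ) :
    ∃ (κ : Type) (_ : Fintype κ) (q : κ → Plane), Generic q ∧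
      Fintype.card κ = 2 ^ j * Fintype.card ι ∧
      doublingPotential (numCross (chi q)) (Fintype.card κ) ≤
        16 ^ j * doublingPotential (numCross (chi p)) (Fintype.card ι) ∧
      ∃ f, IsLineMatching (chi q) f 0 ∨ IsLineMatching (chi q) f 1 := by
  classical
  have h3 : 3 ≤ Fintype.card ι := by
    obtain ⟨k, hk⟩ := hodd
    omega
  induction j with
  | zero =>
    obtain ⟨f, hf⟩ := exists_isLineMatching_of_odd hp (hp.injective h3) hodd h1
    exact ⟨ι, inferInstance, p, hp, by simp, by simp, f, Or.inr hf⟩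
  | succ j ih =>
    obtain ⟨κ, _, q, hq, hcard, hpot, f, hf⟩ := ih
    have hinj : Function.Injective q := hq.injective (by
      rw [hcard]; exact h3.trans (Nat.le_mul_of_pos_left _ (by positivity)))
    have hdouble : ∃ (r : κ × Bool → Plane) (f' : κ × Bool → κ × Bool), Generic r ∧
        IsLineMatching (chi r) f' 0 ∧ (numCross (chi r) : ℤ) ≤ 16 * numCross (chi q) +
          Fintype.card κ * (8 * (Fintype.card κ - 1) ^ 2 - 12 * (Fintype.card κ - 1)) := by
      rcases hf with hf | hf
      · exact exists_doubling_of_even hq hinj hf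
      · exact exists_doubling_of_odd hq hinj hf
    obtain ⟨r, f', hr, hf', hle⟩ := hdouble
    refine ⟨κ × Bool, inferInstance, r, hr, ?_, ?_, f', Or.inl hf'⟩
    · rw [Fintype.card_prod, Fintype.card_bool, hcard]; ring
    · have hle' : (numCross (chi r) : ℝ) ≤ 16 * numCross (chi q) +
          Fintype.card κ * (8 * (Fintype.card κ - 1) ^ 2 - 12 * (Fintype.card κ - 1)) := by
        exact_mod_cast hle
      rw [Fintype.card_prod, Fintype.card_bool, pow_succ]
      simp only [doublingPotential] at hpot ⊢
      push_cast
      -- For `Q n = 3 n ^ 3 - 7 n ^ 2 + (30 / 7) n` one has `16 * Q n = Q (2 n) + 3 * (8 n ^ 3 - 28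
      -- n ^ 2 + 20 n)`, where the last bracket is the extra term of one doubling. This identity
      -- determines the coefficients.
      nlinarith

theorem pow_le_factorial_mul_choose_four {N : ℕ} (hN : 3 ≤ N) :
    ((N : ℝ) - 3) ^ 4 ≤ 24 * (N.choose 4 : ℝ) := by
  have h := Nat.pow_sub_le_descFactorial N 4
  rw [Nat.descFactorial_eq_factorial_mul_choose] at h
  have h' : ((N - 3 : ℕ) : ℝ) ^ 4 ≤ 24 * (N.choose 4 : ℝ) := by exact_mod_cast h
  rwa [Nat.cast_sub hN] at h'

/-- Density monotonicity compares `n` with `N = 2 ^ j * m`. Since `24 * N.choose 4 ≥ (N - 3) ^ 4`,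
only a factor `(1 - 3 / N) ^ 4` is lost, and it tends to 1 as `j` grows. -/
theorem rectilinearCrossingNumber_le_choose (m : ℕ) (hm : Odd m) (hm1 : 1 < m)
    (P : Finset Plane) (hcard : P.card = m) (hP : InGeneralPosition P) (n : ℕ) :
    (rectilinearCrossingNumber n : ℝ) ≤
      (24 * (crossings P : ℝ) + 3 * (m : ℝ) ^ 3 - 7 * (m : ℝ) ^ 2 + (30 / 7) * (m : ℝ))
        / (m : ℝ) ^ 4 * (n.choose 4 : ℝ) := by
  rcases lt_or_ge n 4 with hn | hn
  · simp [rectilinearCrossingNumber_eq_zero hn, Nat.choose_eq_zero_of_lt hn]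
  have h3 : 3 ≤ m := by
    obtain ⟨k, hk⟩ := hm
    omega
  have hcardP : Fintype.card P = m := by rw [Fintype.card_coe, hcard]
  have hgen : Generic (fun x : P => (x : Plane)) := by
    intro a b c hab hac hbc
    exact sign_ne_zero.2 (orient_ne_zero_of_inGeneralPosition hP a.2 b.2 c.2
      (Subtype.coe_injective.ne hab) (Subtype.coe_injective.ne hac)
      (Subtype.coe_injective.ne hbc))
  have hnum : numCross (chi fun x : P => (x : Plane)) = 8 * crossings P := by
    have := eight_mul_crossings_map (Function.Embedding.subtype (· ∈ P)) hgen
    rw [← Finset.attach_eq_univ, Finset.attach_map_val] at this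
    exact this.symm
  set D := 24 * (crossings P : ℝ) + 3 * (m : ℝ) ^ 3 - 7 * (m : ℝ) ^ 2 + (30 / 7) * (m : ℝ) with hD
  have hm0 : (0 : ℝ) < m := by positivity
  have hbound : ∀ j : ℕ, n ≤ 2 ^ j * m →
      (rectilinearCrossingNumber n : ℝ) * (1 - 3 / ((2 ^ j * m : ℕ) : ℝ)) ^ 4
        ≤ D / (m : ℝ) ^ 4 * (n.choose 4 : ℝ) := by
    intro j hj
    obtain ⟨κ, _, q, hq, hcq, hpot, -⟩ := exists_iterated_doubling hgen (by rwa [hcardP])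
      (by rwa [hcardP]) j
    rw [hcardP] at hcq
    have hpot' : doublingPotential (numCross (chi q)) (Fintype.card κ) ≤ 16 ^ j * D := by
      refine hpot.trans_eq ?_
      rw [hnum, hcardP, hD, doublingPotential]
      push_cast
      ring
    have hN3 : 3 ≤ 2 ^ j * m := h3.trans (Nat.le_mul_of_pos_left _ (by positivity))
    set N := 2 ^ j * m with hN
    have hcross : 8 * rectilinearCrossingNumber N ≤ numCross (chi q) := by
      have hinj := hq.injective (by rw [hcq]; exact hN3)
      have h8 : _ = numCross (chi q) := eight_mul_crossings_map ⟨q, hinj⟩ hq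
      rw [← h8]
      have := rectilinearCrossingNumber_le (inGeneralPosition_map ⟨q, hinj⟩ hq)
      rw [Finset.card_map, Finset.card_univ, hcq] at this
      exact Nat.mul_le_mul_left 8 this
    have hN3' : (3 : ℝ) ≤ N := by exact_mod_cast hN3
    have hcross' : 24 * (rectilinearCrossingNumber N : ℝ) ≤ 16 ^ j * D := by
      have h8 : 8 * (rectilinearCrossingNumber N : ℝ) ≤ numCross (chi q) := by
        exact_mod_cast hcross
      rw [hcq, doublingPotential] at hpot'
      -- The polynomial part of the potential at `N` is nonnegative and can be dropped.
      have : 0 ≤ 3 * (N : ℝ) ^ 3 - 7 * (N : ℝ) ^ 2 + (30 / 7) * N := by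
        have : 3 * (N : ℝ) ^ 3 - 7 * (N : ℝ) ^ 2 = N ^ 2 * (3 * N - 7) := by ring
        rw [this]
        have : 0 ≤ 3 * (N : ℝ) - 7 := by linarith
        positivity
      linarith
    have hmono : (rectilinearCrossingNumber n : ℝ) * N.choose 4
        ≤ rectilinearCrossingNumber N * n.choose 4 := by
      exact_mod_cast rectilinearCrossingNumber_mul_choose_le hn hj
    have hN0 : (0 : ℝ) < N := by linarith
    have hN4 : (N : ℝ) ^ 4 = 16 ^ j * (m : ℝ) ^ 4 := by
      rw [hN]; push_cast
      rw [mul_pow, ← pow_mul, mul_comm j 4, pow_mul]; norm_num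
    have e : (1 - 3 / (N : ℝ)) ^ 4 = ((N : ℝ) - 3) ^ 4 / (N : ℝ) ^ 4 := by
      rw [← div_pow, sub_div, div_self hN0.ne']
    rw [e, ← mul_div_assoc, div_le_iff₀ (by positivity), hN4]
    have hfin : D / (m : ℝ) ^ 4 * (n.choose 4 : ℝ) * (16 ^ j * (m : ℝ) ^ 4)
        = 16 ^ j * D * n.choose 4 := by
      field_simp
    rw [hfin]
    calc (rectilinearCrossingNumber n : ℝ) * ((N : ℝ) - 3) ^ 4
        ≤ rectilinearCrossingNumber n * (24 * (N.choose 4 : ℝ)) := by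
          gcongr; exact pow_le_factorial_mul_choose_four hN3
      _ = 24 * (rectilinearCrossingNumber n * (N.choose 4 : ℝ)) := by ring
      _ ≤ 24 * (rectilinearCrossingNumber N * (n.choose 4 : ℝ)) := by gcongr
      _ = 24 * rectilinearCrossingNumber N * (n.choose 4 : ℝ) := by ring
      _ ≤ 16 ^ j * D * n.choose 4 := by gcongr
  have htop : Tendsto (fun j : ℕ => 2 ^ j * m) atTop atTop :=
    (tendsto_pow_atTop_atTop_of_one_lt one_lt_two).atTop_mul_const' (by omega)
  have hlim : Tendsto (fun j : ℕ => (rectilinearCrossingNumber n : ℝ)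
      * (1 - 3 / ((2 ^ j * m : ℕ) : ℝ)) ^ 4) atTop
      (nhds ((rectilinearCrossingNumber n : ℝ) * (1 - 0) ^ 4)) :=
    ((tendsto_const_nhds.sub ((tendsto_const_div_atTop_nhds_zero_nat (3 : ℝ)).comp htop)).pow
      4).const_mul _
  have := le_of_tendsto hlim ((htop.eventually_ge_atTop n).mono hbound)
  simpa using this

theorem theorem5 (m : ℕ) (hm : Odd m) (hm1 : 1 < m)
    (P : Finset Plane) (hcard : P.card = m) (hP : InGeneralPosition P) :
    ∃ g : ℕ → ℝ, (g =Θ[atTop] fun n : ℕ => (n : ℝ) ^ 3) ∧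
      ∀ n : ℕ, (rectilinearCrossingNumber n : ℝ) ≤
        (24 * (crossings P : ℝ) + 3 * (m : ℝ) ^ 3 - 7 * (m : ℝ) ^ 2 + (30 / 7) * (m : ℝ))
            / (m : ℝ) ^ 4 * (n.choose 4 : ℝ) + g n := by
  -- The bound holds without remainder, so any nonnegative function of cubic order serves as `g`.
  refine ⟨fun n => (n : ℝ) ^ 3, isTheta_refl _ _, fun n => ?_⟩
  have := rectilinearCrossingNumber_le_choose m hm hm1 P hcard hP n
  have h0 : (0 : ℝ) ≤ (n : ℝ) ^ 3 := by positivity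
  linarith
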